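/- All graphs are finite and simple. For a graph $G=(V,E)$ and $I\subset\mathbb R$, let $\mathbb P_G(I)$ be the set of real symmetric positive semidefinite matrices $A=(a_{vw})_{v,w\in V}$ with entries in $I$ such that $a_{vw}=0$ whenever $v\neq w$ and $vw\notin E$; write $\mathbb P_G=\mathbb P_G(\mathbb R)$. For $\alpha\in\mathbb R$ and $x\ne0$ put $\psi_\alpha(x)=\operatorname{sgn}(x)|x|^\alpha$ and $\varphi_\alpha(x)=|x|^\alpha$, and put $0^\alpha=\psi_\alpha(0)=\varphi_\alpha(0)=0$ for all $\alpha$. Let $A^{\circ\alpha}$, $\psi_\alpha[A]$, $\varphi_\alpha[A]$ denote entrywise application. The critical exponents of $G$ are $$CE_H(G)=\min\{\alpha\in\mathbb R:\ A^{\circ\beta}\in\mathbb P_G\ \text{for all }A\in\mathbb P_G([0,\infty)),\ \beta\ge\alpha\},$$ $$CE_H^\psi(G)=\min\{\alpha\in\mathbb R:\ \psi_\beta[A]\in\mathbb P_G\ \text{for all }A\in\mathbb P_G,\ \beta\ge\alpha\},$$ $$CE_H^\varphi(G)=\min\{\alpha\in\mathbb R:\ \varphi_\beta[A]\in\mathbb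 P_G\ \text{for all }A\in\mathbb P_G,\ \beta\ge\alpha\}.$$ **Corollary.** Let $G=(V,E)$ be a chordal graph (every cycle with at least four vertices has a chord) with at least one edge, let $V=\{v_1,\dots,v_m\}$, let $C_1,\dots,C_n$ be the maximal cliques of $G$, and let $M(G)=(\mathbf 1(v_i\in C_j))\in\{0,1\}^{m\times n}$, with columns $u_1,\dots,u_n$. Then the three minima above exist, and $$CE_H(G)=CE_H^\psi(G)=CE_H^\varphi(G)=\max_{1\le i,j\le n}\left(u_i^Tu_j-2\delta_{i,j}\right),$$ the largest entry of the matrix $M(G)^TM(G)-2\,\mathrm{Id}_n$. -/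

import Mathlib

/-- A graph is chordal if every cycle with at least four vertices has a chord. -/
def IsChordal {V : Type*} (G : SimpleGraph V) : Prop :=
  ∀ (v : V) (c : G.Walk v v), c.IsCycle → 4 ≤ c.length → ∃ e : Sym2 V, c.IsChord e

/-- The cone `ℙ_G(I)`: real symmetric positive semidefinite matrices with all entries in `I`,
whose `(i, j)` entry vanishes whenever `i ≠ j` and `i`, `j` are not adjacent in `G`. -/
def graphCone {V : Type*} (G : SimpleGraph V) (I : Set ℝ) : Set (Matrix V V ℝ) :=
  {A | A.PosSemidef ∧ (∀ i j, A i j ∈ I) ∧ ∀ i j, i ≠ j → ¬ G.Adj i j → A i j = 0}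

/-- The power function `x ↦ x ^ α` (used on `[0, ∞)` only), with `0 ^ α = 0` for every `α`. -/
noncomputable def powFun (α x : ℝ) : ℝ := if x = 0 then 0 else x ^ α

/-- The odd extension `ψ_α(x) = sgn(x) |x| ^ α`, `ψ_α(0) = 0`. -/
noncomputable def psiFun (α x : ℝ) : ℝ := if x = 0 then 0 else Real.sign x * |x| ^ α

/-- The even extension `φ_α(x) = |x| ^ α`, `φ_α(0) = 0`. -/
noncomputable def phiFun (α x : ℝ) : ℝ := if x = 0 then 0 else |x| ^ α

/-- `c` is the critical exponent of `G` for the family of entrywise functions `f β` on `ℙ_G(I)`: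
it is the minimum of the set of `α` such that, for every `A ∈ ℙ_G(I)` and every `β ≥ α`, the
matrix `f_β[A]` belongs to `ℙ_G(ℝ)`. -/
def IsCriticalExponent {V : Type*} (f : ℝ → ℝ → ℝ) (I : Set ℝ) (G : SimpleGraph V) (c : ℝ) :
    Prop :=
  IsLeast {α : ℝ | ∀ A ∈ graphCone G I, ∀ β : ℝ, α ≤ β → A.map (f β) ∈ graphCone G Set.univ} c

/-- `CE_H(G) = c`. -/
def IsCEH {V : Type*} (G : SimpleGraph V) (c : ℝ) : Prop :=
  IsCriticalExponent powFun (Set.Ici 0) G c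

/-- `CE_H^ψ(G) = c`. -/
def IsCEHpsi {V : Type*} (G : SimpleGraph V) (c : ℝ) : Prop :=
  IsCriticalExponent psiFun Set.univ G c

/-- `CE_H^φ(G) = c`. -/
def IsCEHphi {V : Type*} (G : SimpleGraph V) (c : ℝ) : Prop :=
  IsCriticalExponent phiFun Set.univ G c

/-- The type of maximal cliques of `G`. -/
abbrev MaxClique {V : Type*} (G : SimpleGraph V) : Type _ :=
  {C : Finset V // Maximal (fun s : Finset V => G.IsClique (s : Set V)) C}

/-- The maximal clique matrix `M(G)`: rows are indexed by vertices, columns by maximal cliques,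
and the entry at `(v, C)` is `1` if `v ∈ C` and `0` otherwise. -/
def maxCliqueMatrix {V : Type*} [DecidableEq V] (G : SimpleGraph V) :
    Matrix V (MaxClique G) ℝ :=
  Matrix.of fun v C => if v ∈ C.1 then 1 else 0

/-!
The largest entry `r` of `Mᵀ M - 2` is the least natural number such that `G` has no clique of size
`r + 3` and no clique of size `r + 1` in the common neighbourhood of two non-adjacent vertices.

Upper bound. Matrices with entries of arbitrary sign contain the nonnegative case, so only the odd
and even powers `signPow` are considered. For `β ≥ n - 2 ≥ 0` they preserve positive
semidefiniteness of `n × n` matrices (`Matrix.PosSemidef.map_signPow`): subtract a rank one matrix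
`ζ ζᵀ` that clears a row and differentiate along the segment from `ζ ζᵀ` to `A`; by the Schur
product theorem this reduces `(n, β)` to `(n - 1, β - 1)`, with the parity of the power exchanged. Differentiating once
and twice more gives Loewner monotonicity for `β ≥ n - 1` and Loewner superadditivity for `β ≥ n`
(`Matrix.PosSemidef.map_signPow_add_sub`). A chordal graph that is not complete has a clique
separator all of whose vertices are adjacent to two common non-adjacent vertices
(`IsChordal.exists_separation`), hence of size at most `r`. Gaussian elimination splits a matrix in
the cone into positive semidefinite summands living on the two sides of the separator, and
superadditivity on the separator shows that the power of the sum dominates the sum of the powers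
(`IsChordal.posSemidef_map_signPow`).
All that is used of chordality is that the neighbours of a vertex in a connected set form a
connected set (`IsChordal.walkConnected_neighborSet_inter`).

Lower bound. For `r ≥ 1` there are an `r`-clique and two further vertices adjacent to all of it: the
rest of an `(r + 2)`-clique, or one vertex from each of two maximal cliques meeting in `r`
vertices. For `r - 1 < β < r` superadditivity fails on `r × r` matrices, as the Taylor expansion of
`(1 + ε k l) ^ β` shows when tested against weights that annihilate `k, …, k ^ (r - 1)` but not
`k ^ β` (`exists_weights`, `exists_sum_rpow_neg`). This failure is the Schur complement of the power
of a matrix in the cone (`exists_not_posSemidef_of_clique`). For `r = 0` a single edge suffices.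
-/

/-! ### Chordal graphs: connectivity and separators -/

/-- A set of vertices is walk-connected if any two of its members are joined by a walk that stays
inside the set. The empty set is walk-connected. -/
def WalkConnected {V : Type*} (G : SimpleGraph V) (X : Set V) : Prop :=
  ∀ u ∈ X, ∀ w ∈ X, ∃ p : G.Walk u w, ∀ z ∈ p.support, z ∈ X

namespace WalkConnected

variable {V : Type*} {G : SimpleGraph V}

/-- A walk-connected set has no nontrivial partition into parts without edges in between. -/
lemma exists_adj {X : Set V} (hX : WalkConnected G X) {P : Set V} {u w : V}
    (hu : u ∈ X) (huP : u ∈ P) (hw : w ∈ X) (hwP : w ∉ P) :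
    ∃ a ∈ X ∩ P, ∃ b ∈ X \ P, G.Adj a b := by
  obtain ⟨p, hp⟩ := hX u hu w hw
  clear hu hw
  induction p with
  | nil => exact absurd huP hwP
  | @cons u v w h q ih =>
    by_cases hv : v ∈ P
    · exact ih hv hwP fun z hz => hp z (by simp [hz])
    · exact ⟨u, ⟨hp u (by simp), huP⟩, v, ⟨hp v (by simp), hv⟩, h⟩

lemma of_common_root {X : Set V} {x : V}
    (h : ∀ u ∈ X, ∃ p : G.Walk x u, ∀ z ∈ p.support, z ∈ X) : WalkConnected G X := by
  intro u hu w hw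
  obtain ⟨p, hp⟩ := h u hu
  obtain ⟨q, hq⟩ := h w hw
  refine ⟨p.reverse.append q, fun z hz => ?_⟩
  rw [SimpleGraph.Walk.mem_support_append_iff] at hz
  rcases hz with hz | hz
  · exact hp z (by simpa using hz)
  · exact hq z hz

/-- Adjoining a vertex with a neighbour in the set preserves connectedness. -/
lemma insert {X : Set V} (hX : WalkConnected G X) {s a : V} (ha : a ∈ X) (hs : G.Adj s a) :
    WalkConnected G (insert s X) := by
  apply of_common_root (x := s)
  intro u hu
  rcases hu with rfl | hu
  · exact ⟨.nil, by simp⟩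
  · obtain ⟨p, hp⟩ := hX a ha u hu
    refine ⟨.cons hs p, fun z hz => ?_⟩
    rw [SimpleGraph.Walk.support_cons, List.mem_cons] at hz
    rcases hz with rfl | hz
    · exact Set.mem_insert _ _
    · exact Set.mem_insert_of_mem _ (hp z hz)

end WalkConnected

namespace IsChordal

open SimpleGraph

variable {V : Type*} {G : SimpleGraph V}

/-- In a chordal graph, the neighbours of a vertex `s` inside a connected set `X` avoiding `s` form
a connected set: a shortest walk in `X` between two of them that leaves the neighbourhood of `s`
would close up, through `s`, to a chordless cycle. -/
lemma walkConnected_neighborSet_inter (hG : IsChordal G) {X : Set V} (hX : WalkConnected G X)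
    {s : V} (hs : s ∉ X) : WalkConnected G (G.neighborSet s ∩ X) := by
  classical
  suffices H : ∀ n : ℕ, ∀ u w : V, G.Adj s u → G.Adj s w → ∀ p : G.Walk u w, p.length = n →
      (∀ z ∈ p.support, z ∈ X) → ∃ q : G.Walk u w, ∀ z ∈ q.support, z ∈ G.neighborSet s ∩ X by
    intro u hu w hw
    obtain ⟨p, hp⟩ := hX u hu.2 w hw.2
    exact H _ u w hu.1 hw.1 p rfl hp
  intro n
  induction n using Nat.strong_induction_on with
  | _ n ih =>
  intro u w hu hw p hpn hpX
  -- a walk with an interior neighbour of `s` splits into two shorter ones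
  by_cases hint : ∃ k, 0 < k ∧ k < p.length ∧ G.Adj s (p.getVert k)
  · obtain ⟨k, hk0, hkn, hk⟩ := hint
    obtain ⟨q₁, hq₁⟩ := ih k (by omega) u _ hu hk (p.take k)
      (by rw [Walk.take_length]; omega)
      (fun z hz => hpX z ((p.isSubwalk_take k).support_subset hz))
    obtain ⟨q₂, hq₂⟩ := ih (p.length - k) (by omega) _ w hk hw (p.drop k)
      (by rw [Walk.drop_length])
      (fun z hz => hpX z ((p.isSubwalk_drop k).support_subset hz))
    refine ⟨q₁.append q₂, fun z hz => ?_⟩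
    rw [Walk.mem_support_append_iff] at hz
    exact hz.elim (hq₁ z) (hq₂ z)
  push Not at hint
  by_cases hpath : p.IsPath
  swap
  · refine ih p.bypass.length ?_ u w hu hw p.bypass rfl
      fun z hz => hpX z (p.support_bypass_subset_support hz)
    rw [← hpn]
    by_contra hlt
    exact hpath (p.bypass_eq_self_of_length_le_length_bypass (not_lt.1 hlt) ▸ p.bypass_isPath)
  -- an edge between non-consecutive vertices is a shortcut
  by_cases hshort : ∃ i j, i + 2 ≤ j ∧ j ≤ p.length ∧ G.Adj (p.getVert i) (p.getVert j)
  · obtain ⟨i, j, hij, hj, hadj⟩ := hshort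
    refine ih _ ?_ u w hu hw ((p.take i).append (.cons hadj (p.drop j))) rfl fun z hz => ?_
    · rw [Walk.length_append, Walk.length_cons, Walk.take_length, Walk.drop_length]
      omega
    · rw [Walk.mem_support_append_iff, Walk.support_cons, List.mem_cons] at hz
      rcases hz with hz | rfl | hz
      · exact hpX z ((p.isSubwalk_take i).support_subset hz)
      · exact hpX _ (p.getVert_mem_support i)
      · exact hpX z ((p.isSubwalk_drop j).support_subset hz)
  push Not at hshort
  have hsp : s ∉ p.support := fun h => hs (hpX s h)
  by_cases hlen : p.length ≤ 1
  · refine ⟨p, fun z hz => ⟨?_, hpX z hz⟩⟩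
    obtain ⟨k, rfl, hk⟩ := Walk.mem_support_iff_exists_getVert.1 hz
    rcases Nat.eq_zero_or_pos k with rfl | hk0
    · simpa using hu
    · obtain rfl : k = p.length := by omega
      simpa using hw
  -- otherwise the cycle through `s` and the walk has no chord
  exfalso
  have huw : u ≠ w := by
    rintro rfl
    rw [Walk.isPath_iff_nil, ← Walk.length_eq_zero_iff] at hpath
    omega
  have hcyc : (Walk.cons hu (p.concat hw.symm)).IsCycle := by
    rw [Walk.cons_isCycle_iff]
    refine ⟨(Walk.concat_isPath_iff _).2 ⟨hpath, hsp⟩, ?_⟩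
    rw [Walk.edges_concat, List.concat_eq_append, List.mem_append, List.mem_singleton]
    rintro (h | h)
    · exact hsp (p.fst_mem_support_of_mem_edges h)
    · rw [Sym2.eq_iff] at h
      rcases h with ⟨rfl, rfl⟩ | ⟨_, h⟩
      · exact huw rfl
      · exact huw h
  obtain ⟨e, he⟩ := hG s _ hcyc (by simp; omega)
  induction e using Sym2.ind with | _ x y
  rw [Walk.isChord_sym2Mk] at he
  obtain ⟨hxy, hne, hx, hy⟩ := he
  have hends : ∀ y ∈ p.support, G.Adj s y → y = u ∨ y = w := by
    intro y hy hsy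
    obtain ⟨k, rfl, hk⟩ := Walk.mem_support_iff_exists_getVert.1 hy
    by_contra hcon
    push Not at hcon
    refine hint k ?_ ?_ hsy
    · rcases Nat.eq_zero_or_pos k with rfl | h
      · exact absurd (p.getVert_zero) hcon.1
      · exact h
    · rcases hk.lt_or_eq with h | rfl
      · exact h
      · exact absurd (p.getVert_length) hcon.2
  have hconsec : ∀ i j, i < j → j ≤ p.length → G.Adj (p.getVert i) (p.getVert j) →
      s(p.getVert i, p.getVert j) ∈ p.edges := by
    intro i j hij hj hadj
    by_cases h : i + 2 ≤ j
    · exact absurd hadj (hshort i j h hj)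
    · obtain rfl : j = i + 1 := by omega
      exact p.adj_toSubgraph_iff_mem_edges.1 (p.toSubgraph_adj_getVert (by omega))
  simp only [Walk.edges_cons, Walk.edges_concat, List.mem_cons, List.concat_eq_append,
    List.mem_append, not_or, Walk.support_cons, Walk.support_concat] at hne hx hy
  have hspecial : ∀ y, G.Adj s y → y ∈ p.support → s(s, y) = s(s, u) ∨ s(s, y) = s(w, s) := by
    intro y hsy hy
    rcases hends y hy hsy with rfl | rfl
    · exact Or.inl rfl
    · exact Or.inr Sym2.eq_swap
  have hx' : x = s ∨ x ∈ p.support := by tauto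
  have hy' : y = s ∨ y ∈ p.support := by tauto
  rcases hx' with rfl | hx' <;> rcases hy' with rfl | hy'
  · exact hxy.ne rfl
  · rcases hspecial y hxy hy' with h | h
    · exact hne.1 h
    · exact hne.2.2.1 h
  · rcases hspecial x hxy.symm hx' with h | h
    · exact hne.1 (Sym2.eq_swap.trans h)
    · exact hne.2.2.1 (Sym2.eq_swap.trans h)
  · obtain ⟨i, rfl, hi⟩ := Walk.mem_support_iff_exists_getVert.1 hx'
    obtain ⟨j, rfl, hj⟩ := Walk.mem_support_iff_exists_getVert.1 hy'
    rcases lt_trichotomy i j with h | rfl | h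
    · exact hne.2.1 (hconsec i j h hj hxy)
    · exact hxy.ne rfl
    · exact hne.2.1 (Sym2.eq_swap ▸ hconsec j i h hi hxy.symm)

/-- In a chordal graph, if every vertex of a clique `S` has a neighbour in a connected set `X`
disjoint from `S`, then one vertex of `X` is adjacent to all of `S`. -/
lemma exists_adj_all (hG : IsChordal G) (S : Finset V) :
    ∀ X : Set V, WalkConnected G X → X.Nonempty → (∀ s ∈ S, s ∉ X) → G.IsClique (S : Set V) →
      (∀ s ∈ S, ∃ a ∈ X, G.Adj s a) → ∃ a ∈ X, ∀ s ∈ S, G.Adj s a := by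
  classical
  induction S using Finset.induction_on with
  | empty => intro X _ ⟨a, ha⟩ _ _ _; exact ⟨a, ha, by simp⟩
  | @insert t S ht ih =>
    intro X hX _ hdisj hcl hnb
    obtain ⟨a, haX, hta⟩ := hnb t (by simp)
    have htX : t ∉ X := hdisj t (by simp)
    have hnb' : ∀ s ∈ S, ∃ c ∈ G.neighborSet t ∩ X, G.Adj s c := by
      intro s hs
      have hst : s ≠ t := fun h => ht (h ▸ hs)
      obtain ⟨d, hdX, hsd⟩ := hnb s (by simp [hs])
      have hts : G.Adj t s := hcl (by simp) (by simp [hs]) hst.symm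
      have hcon := hG.walkConnected_neighborSet_inter (hX.insert hdX hsd)
        (s := t) (by simp [hst.symm, htX])
      obtain ⟨x, hx, y, hy, hxy⟩ := hcon.exists_adj (P := {s}) (u := s) (w := a)
        ⟨hts, by simp⟩ rfl ⟨hta, by simp [haX]⟩
        (fun h => hdisj s (by simp [hs]) (Set.mem_singleton_iff.1 h ▸ haX))
      obtain rfl : x = s := hx.2
      exact ⟨y, ⟨hy.1.1, hy.1.2.resolve_left hy.2⟩, hxy⟩
    obtain ⟨b, hb, hball⟩ := ih (G.neighborSet t ∩ X)
      (hG.walkConnected_neighborSet_inter hX htX) ⟨a, hta, haX⟩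
      (fun s hs h => hdisj s (by simp [hs]) h.2)
      (hcl.subset (by simp)) hnb'
    refine ⟨b, hb.2, fun s hs => ?_⟩
    rcases Finset.mem_insert.1 hs with rfl | hs
    · exact hb.1
    · exact hball s hs

/-- A set of vertices `U` of a chordal graph that is not a clique splits as `X ∪ S ∪ (the rest)`
without edges between `X` and the rest, where the separator `S` is a clique, and some two
non-adjacent vertices are both adjacent to all of `S`. -/
lemma exists_separation [DecidableEq V] (hG : IsChordal G) {U : Finset V}
    (hU : ¬ G.IsClique (U : Set V)) :
    ∃ X S : Finset V, X ⊆ U ∧ S ⊆ U ∧ X.Nonempty ∧ X ∪ S ≠ U ∧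
      G.IsClique (S : Set V) ∧ (∀ i ∈ X, ∀ j ∈ U, G.Adj i j → j ∈ X ∪ S) ∧
      ∃ a b : V, a ≠ b ∧ ¬ G.Adj a b ∧ ∀ s ∈ S, G.Adj s a ∧ G.Adj s b := by
  classical
  rw [SimpleGraph.isClique_iff, Set.Pairwise] at hU
  push Not at hU
  obtain ⟨x, hx, y, hy, hne, hxy⟩ := hU
  -- `X` is the component of `x` after removal of `y` and its neighbours
  set W : Set V := {z | z ∈ U ∧ z ≠ y ∧ ¬ G.Adj z y} with hW
  set X : Finset V := U.filter fun z => ∃ p : G.Walk x z, ∀ v ∈ p.support, v ∈ W with hXdef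
  set S : Finset V := U.filter fun z => z ∉ X ∧ ∃ a ∈ X, G.Adj z a with hSdef
  have hxW : x ∈ W := ⟨hx, hne, hxy⟩
  have hxX : x ∈ X := by
    rw [hXdef, Finset.mem_filter]
    exact ⟨hx, .nil, by simpa using hxW⟩
  have hXW : ∀ z ∈ X, z ∈ W := by
    intro z hz
    obtain ⟨-, p, hp⟩ := Finset.mem_filter.1 hz
    exact hp z p.end_mem_support
  have hXstep : ∀ a ∈ X, ∀ z ∈ W, G.Adj a z → z ∈ X := by
    intro a ha z hz haz
    obtain ⟨-, p, hp⟩ := Finset.mem_filter.1 ha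
    refine Finset.mem_filter.2 ⟨hz.1, p.concat haz, fun v hv => ?_⟩
    rw [Walk.support_concat, List.mem_append, List.mem_singleton] at hv
    rcases hv with hv | rfl
    · exact hp v hv
    · exact hz
  have hXconn : WalkConnected G (X : Set V) := by
    apply WalkConnected.of_common_root (x := x)
    intro u hu
    obtain ⟨-, p, hp⟩ := Finset.mem_filter.1 hu
    refine ⟨p, fun z hz => Finset.mem_coe.2 <| Finset.mem_filter.2 ⟨(hp z hz).1, p.takeUntil z hz,
      fun v hv => hp v (p.support_takeUntil_subset_support hz hv)⟩⟩
  have hyX : y ∉ X := fun h => (hXW y h).2.1 rfl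
  have hSy : ∀ s ∈ S, G.Adj s y := by
    intro s hs
    obtain ⟨hsU, hsX, a, ha, hsa⟩ := Finset.mem_filter.1 hs
    by_contra h
    refine hsX (hXstep a ha s ⟨hsU, ?_, h⟩ hsa.symm)
    rintro rfl
    exact (hXW a ha).2.2 hsa.symm
  have hScl : G.IsClique (S : Set V) := by
    intro s hs t ht hst
    by_contra hnadj
    obtain ⟨hsU, hsX, a, ha, hsa⟩ := Finset.mem_filter.1 hs
    obtain ⟨htU, htX, b, hb, htb⟩ := Finset.mem_filter.1 ht
    have hsy := hSy s hs
    have hty := hSy t ht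
    -- `X ∪ {s, y}` is connected, but `y` is isolated among the neighbours of `t` in it
    have hcon := hG.walkConnected_neighborSet_inter
      ((hXconn.insert ha hsa).insert (s := y) (Set.mem_insert s _) hsy.symm) (s := t)
      (by simp [hty.ne, Ne.symm hst, htX])
    obtain ⟨c, hc, d, hd, hcd⟩ := hcon.exists_adj (P := {y}) (u := y) (w := b)
      ⟨hty, by simp⟩ rfl ⟨htb, by simp [hb]⟩
      (fun h => hyX (Set.mem_singleton_iff.1 h ▸ hb))
    obtain rfl : c = y := hc.2
    rcases hd.1.2 with h | rfl | h
    · exact hd.2 h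
    · exact hnadj (SimpleGraph.Adj.symm hd.1.1)
    · exact (hXW d h).2.2 hcd.symm
  have hSX : ∀ s ∈ S, s ∉ (X : Set V) := fun s hs => (Finset.mem_filter.1 hs).2.1
  obtain ⟨a, haX, ha⟩ := hG.exists_adj_all S X hXconn ⟨x, hxX⟩ hSX hScl
    fun s hs => (Finset.mem_filter.1 hs).2.2
  refine ⟨X, S, Finset.filter_subset _ _, Finset.filter_subset _ _, ⟨x, hxX⟩, ?_, hScl, ?_, a, y,
    (hXW a haX).2.1, (hXW a haX).2.2, fun s hs => ⟨ha s hs, hSy s hs⟩⟩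
  · intro h
    rcases Finset.mem_union.1 (h.symm ▸ hy : y ∈ X ∪ S) with h | h
    · exact hyX h
    · exact (hSy y h).ne rfl
  · intro i hi j hj hij
    rw [Finset.mem_union]
    by_cases hjX : j ∈ X
    · exact Or.inl hjX
    · exact Or.inr (Finset.mem_filter.2 ⟨hj, hjX, i, hi, hij.symm⟩)

end IsChordal

/-! ### Signed powers -/

/-- The odd (`σ = true`) or even (`σ = false`) extension of `x ↦ x ^ β` to the real line, with value
`0` at `0` for every `β`. Differentiation exchanges the two families, which is why they are treated
together. -/
noncomputable def signPow (σ : Bool) (β x : ℝ) : ℝ :=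
  if x = 0 then 0 else (if σ then Real.sign x else 1) * |x| ^ β

section SignPow

open Filter Topology

@[simp] lemma signPow_zero (σ : Bool) (β : ℝ) : signPow σ β 0 = 0 := if_pos rfl

lemma signPow_true (β : ℝ) : signPow true β = psiFun β := by
  ext x; simp [signPow, psiFun]

lemma signPow_false (β : ℝ) : signPow false β = phiFun β := by
  ext x; simp [signPow, phiFun]

lemma signPow_of_pos (σ : Bool) (β : ℝ) {x : ℝ} (hx : 0 < x) : signPow σ β x = x ^ β := by
  cases σ <;> simp [signPow, hx.ne', abs_of_pos hx, Real.sign_of_pos hx]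

lemma signPow_of_neg (σ : Bool) (β : ℝ) {x : ℝ} (hx : x < 0) :
    signPow σ β x = (if σ then -1 else 1) * (-x) ^ β := by
  cases σ <;> simp [signPow, hx.ne, abs_of_neg hx, Real.sign_of_neg hx]

lemma signPow_of_nonneg (σ : Bool) (β : ℝ) {x : ℝ} (hx : 0 ≤ x) :
    signPow σ β x = powFun β x := by
  rcases hx.eq_or_lt with rfl | hx
  · simp [powFun]
  · rw [signPow_of_pos σ β hx, powFun, if_neg hx.ne']

lemma signPow_mul (σ : Bool) (β x y : ℝ) :
    signPow σ β (x * y) = signPow σ β x * signPow σ β y := by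
  rcases lt_trichotomy x 0 with hx | rfl | hx
  · rcases lt_trichotomy y 0 with hy | rfl | hy
    · rw [signPow_of_pos _ _ (mul_pos_of_neg_of_neg hx hy), signPow_of_neg _ _ hx,
        signPow_of_neg _ _ hy, ← neg_mul_neg, Real.mul_rpow (by linarith) (by linarith)]
      cases σ <;> simp
    · simp
    · rw [signPow_of_neg _ _ (mul_neg_of_neg_of_pos hx hy), signPow_of_neg _ _ hx,
        signPow_of_pos _ _ hy, ← neg_mul, Real.mul_rpow (by linarith) hy.le]
      ring
  · simp
  · rcases lt_trichotomy y 0 with hy | rfl | hy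
    · rw [signPow_of_neg _ _ (mul_neg_of_pos_of_neg hx hy), signPow_of_pos _ _ hx,
        signPow_of_neg _ _ hy, ← mul_neg, Real.mul_rpow hx.le (by linarith)]
      ring
    · simp
    · rw [signPow_of_pos _ _ (mul_pos hx hy), signPow_of_pos _ _ hx,
        signPow_of_pos _ _ hy, Real.mul_rpow hx.le hy.le]

lemma signPow_nonneg (σ : Bool) (β : ℝ) {x : ℝ} (hx : 0 ≤ x) : 0 ≤ signPow σ β x := by
  rcases hx.eq_or_lt with rfl | hx
  · simp
  · rw [signPow_of_pos σ β hx]; positivity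

lemma signPow_le_signPow (σ : Bool) {β : ℝ} (hβ : 0 ≤ β) {x y : ℝ} (hx : 0 ≤ x) (hxy : x ≤ y) :
    signPow σ β x ≤ signPow σ β y := by
  rcases hx.eq_or_lt with rfl | hx
  · simpa using signPow_nonneg σ β hxy
  · rw [signPow_of_pos σ β hx, signPow_of_pos σ β (hx.trans_le hxy)]
    exact Real.rpow_le_rpow hx.le hxy hβ

lemma continuous_signPow_exponent (σ : Bool) (x : ℝ) : Continuous fun β => signPow σ β x := by
  rcases eq_or_ne x 0 with rfl | hx
  · simpa using continuous_const
  · simp only [signPow, if_neg hx]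
    exact continuous_const.mul
      (continuous_const.rpow continuous_id fun _ => Or.inl (abs_ne_zero.2 hx))

/-- The derivative of an even power is a multiple of an odd power, and conversely. -/
lemma hasDerivAt_signPow (σ : Bool) {β : ℝ} (hβ : 1 < β) (x : ℝ) :
    HasDerivAt (signPow σ β) (β * signPow (!σ) (β - 1) x) x := by
  rcases lt_trichotomy x 0 with hx | rfl | hx
  · have h1 : HasDerivAt (fun y : ℝ => (if σ then (-1 : ℝ) else 1) * (-y) ^ β)
        ((if σ then (-1 : ℝ) else 1) * (-1 * β * (-x) ^ (β - 1))) x :=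
      (((hasDerivAt_id x).neg).rpow_const (Or.inl (by simpa using hx.ne))).const_mul _
    refine (h1.congr_of_eventuallyEq ?_).congr_deriv ?_
    · filter_upwards [Iio_mem_nhds hx] with y hy
      exact signPow_of_neg σ β hy
    · rw [signPow_of_neg _ _ hx]
      cases σ <;> simp
  · have h0 : HasDerivAt (fun y : ℝ => |y| ^ β) 0 0 := by
      simpa using hasDerivAt_abs_rpow (0 : ℝ) hβ
    rw [signPow_zero, mul_zero]
    rw [hasDerivAt_iff_isLittleO] at h0 ⊢
    refine Asymptotics.IsLittleO.congr' (f₁ := fun y => signPow σ β y) ?_ (by simp) (by rfl)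
    refine (Asymptotics.IsBigO.of_bound 1 (Eventually.of_forall fun y => ?_)).trans_isLittleO h0
    have hβ0 : β ≠ 0 := by linarith
    simp only [abs_zero, Real.zero_rpow hβ0, sub_zero, smul_zero, one_mul]
    rcases lt_trichotomy y 0 with hy | rfl | hy
    · rw [signPow_of_neg _ _ hy, abs_of_neg hy]
      cases σ <;> simp
    · simp
    · rw [signPow_of_pos _ _ hy, abs_of_pos hy]
  · refine ((Real.hasDerivAt_rpow_const (p := β) (Or.inl hx.ne')).congr_of_eventuallyEq
      ?_).congr_deriv ?_
    · filter_upwards [Ioi_mem_nhds hx] with y hy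
      exact signPow_of_pos σ β hy
    · rw [signPow_of_pos _ _ hx]

end SignPow

/-! ### Positive semidefinite matrices -/

namespace Matrix

open Filter Topology

variable {V : Type*} {A B : Matrix V V ℝ}

lemma PosSemidef.apply_symm (hA : A.PosSemidef) (i j : V) : A i j = A j i := by
  simpa using hA.1.apply j i

lemma IsHermitian.map_real (hA : A.IsHermitian) (f : ℝ → ℝ) : (A.map f).IsHermitian := by
  ext i j
  have := hA.apply i j
  simp only [star_trivial] at this
  simp [this]

/-- All nonzero entries of the matrix lie in `U × U`. -/
def SupportedOn (A : Matrix V V ℝ) (U : Finset V) : Prop :=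
  ∀ i j, i ∉ U ∨ j ∉ U → A i j = 0

lemma SupportedOn.apply_eq_zero_of_card_le_one {U : Finset V} (hA : A.SupportedOn U)
    (hU : U.card ≤ 1) {i j : V} (hij : i ≠ j) : A i j = 0 := by
  apply hA
  by_contra! h
  exact hij (Finset.card_le_one.1 hU i h.1 j h.2)

lemma SupportedOn.eq_zero (hA : A.SupportedOn ∅) : A = 0 := by
  ext i j; exact hA i j (by simp)

lemma SupportedOn.add {U : Finset V} (hA : A.SupportedOn U) (hB : B.SupportedOn U) :
    (A + B).SupportedOn U := fun i j h => by simp [hA i j h, hB i j h]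

lemma SupportedOn.smul {U : Finset V} (hA : A.SupportedOn U) (c : ℝ) :
    (c • A).SupportedOn U := fun i j h => by simp [hA i j h]

/-- The matrix `A` with all entries outside `W × W` replaced by zero. -/
noncomputable def restrict (W : Finset V) [DecidableEq V] (A : Matrix V V ℝ) : Matrix V V ℝ :=
  Matrix.of fun i j => if i ∈ W ∧ j ∈ W then A i j else 0

lemma supportedOn_restrict [DecidableEq V] (W : Finset V) (A : Matrix V V ℝ) :
    (restrict W A).SupportedOn W := by
  intro i j h
  rw [restrict, of_apply, if_neg (by tauto)]

/-- The Schur product theorem for real matrices. -/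
lemma PosSemidef.hadamard_real (hA : A.PosSemidef) (hB : B.PosSemidef) : (A ⊙ B).PosSemidef :=
  hA.hadamard hB

variable [Fintype V]

lemma posSemidef_vecMulVec_self (ζ : V → ℝ) : (vecMulVec ζ ζ).PosSemidef := by
  simpa using posSemidef_vecMulVec_self_star ζ

/-- Subtracting from a positive semidefinite matrix a suitable rank one matrix clears a given row
and column (one step of symmetric Gaussian elimination). -/
lemma PosSemidef.exists_sub_vecMulVec [DecidableEq V] (hA : A.PosSemidef) (p : V) :
    ∃ ζ : V → ℝ, (A - vecMulVec ζ ζ).PosSemidef ∧ (∀ j, (A - vecMulVec ζ ζ) p j = 0) ∧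
      (∀ i, ζ i = A p i / √(A p p)) := by
  have hpp : 0 ≤ A p p := hA.diag_nonneg
  have hquad : ∀ (x : V → ℝ) (c : ℝ), 0 ≤ x ⬝ᵥ A *ᵥ x + 2 * c * (A p ⬝ᵥ x) + c ^ 2 * A p p := by
    intro x c
    have h := hA.dotProduct_mulVec_nonneg (x + c • Pi.single p 1)
    have h1 : x ⬝ᵥ A *ᵥ Pi.single p 1 = A p ⬝ᵥ x := by
      rw [mulVec_single_one, dotProduct_comm]
      congr 1
      ext i
      exact hA.apply_symm i p
    have h2 : (Pi.single p 1 : V → ℝ) ⬝ᵥ A *ᵥ x = A p ⬝ᵥ x := by simp [mulVec]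
    have h3 : (Pi.single p 1 : V → ℝ) ⬝ᵥ A *ᵥ Pi.single p 1 = A p p := by simp
    rw [star_trivial, mulVec_add, mulVec_smul, add_dotProduct, dotProduct_add, dotProduct_add,
      smul_dotProduct, smul_dotProduct, dotProduct_smul, dotProduct_smul, h1, h2, h3] at h
    simp only [smul_eq_mul] at h
    linarith
  have hsub : ∀ ζ x : V → ℝ, x ⬝ᵥ (A - vecMulVec ζ ζ) *ᵥ x = x ⬝ᵥ A *ᵥ x - (ζ ⬝ᵥ x) ^ 2 := by
    intro ζ x
    rw [sub_mulVec, dotProduct_sub, vecMulVec_mulVec, dotProduct_comm x (_ • _)]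
    simp
    ring
  refine ⟨fun i => A p i / √(A p p), ?_, ?_, fun i => rfl⟩
  · refine PosSemidef.of_dotProduct_mulVec_nonneg
      (hA.1.sub (posSemidef_vecMulVec_self _).1) fun x => ?_
    rw [star_trivial, hsub]
    have hdot : (fun i => A p i / √(A p p)) ⬝ᵥ x = (A p ⬝ᵥ x) / √(A p p) := by
      simp only [dotProduct, Finset.sum_div]
      exact Finset.sum_congr rfl fun i _ => by ring
    rw [hdot, div_pow, Real.sq_sqrt hpp]
    have h := hquad x (-(A p ⬝ᵥ x) / A p p)
    rcases hpp.eq_or_lt with h0 | h0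
    · simpa [← h0] using h
    · have : x ⬝ᵥ A *ᵥ x + 2 * (-(A p ⬝ᵥ x) / A p p) * (A p ⬝ᵥ x)
          + (-(A p ⬝ᵥ x) / A p p) ^ 2 * A p p = x ⬝ᵥ A *ᵥ x - (A p ⬝ᵥ x) ^ 2 / A p p := by
        field_simp
        ring
      linarith
  · intro j
    simp only [sub_apply, vecMulVec_apply]
    rw [div_mul_div_comm, Real.mul_self_sqrt hpp]
    rcases hpp.eq_or_lt with h0 | h0
    · -- a zero diagonal entry forces the row to vanish
      rw [← h0, div_zero, sub_zero]
      by_contra hne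
      have h := hquad (Pi.single j 1) (-(A j j + 1) / (2 * A p j))
      rw [← h0] at h
      simp only [mulVec_single_one, single_one_dotProduct, dotProduct_single_one, col_apply,
        mul_zero, add_zero] at h
      have : 2 * (-(A j j + 1) / (2 * A p j)) * A p j = -(A j j + 1) := by field_simp
      linarith
    · field_simp
      ring

lemma PosSemidef.apply_eq_zero (hA : A.PosSemidef) {p : V} (hp : A p p = 0) (j : V) :
    A p j = 0 := by
  classical
  obtain ⟨ζ, -, h, hζ⟩ := hA.exists_sub_vecMulVec p
  have := h j
  simpa [hζ, hp, vecMulVec_apply] using this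

/-- Clearing the row and column of `p` keeps the support otherwise. -/
lemma SupportedOn.sub_vecMulVec_erase [DecidableEq V] {U : Finset V} (hAU : A.SupportedOn U)
    (hA : A.PosSemidef) {p : V} {ζ : V → ℝ} (hrow : ∀ j, (A - vecMulVec ζ ζ) p j = 0)
    (hζ : ∀ i, ζ i = A p i / √(A p p)) : (A - vecMulVec ζ ζ).SupportedOn (U.erase p) := by
  have hsymm := (hA.1.sub (posSemidef_vecMulVec_self ζ).1).apply
  have hζU : ∀ i, i ∉ U → ζ i = 0 := fun i hi => by simp [hζ, hAU p i (Or.inr hi)]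
  intro i j hij
  by_cases hi : i = p
  · rw [hi]; exact hrow j
  by_cases hj : j = p
  · have := hsymm i j
    rw [star_trivial] at this
    rw [← this, hj]
    exact hrow i
  have hij' : i ∉ U ∨ j ∉ U := by
    simp only [Finset.mem_erase, not_and] at hij
    exact hij.imp (fun h => h hi) fun h => h hj
  rw [sub_apply, hAU i j hij', vecMulVec_apply]
  rcases hij' with h | h <;> simp [hζU _ h]

/-- Elimination of a set `X` of rows: a positive semidefinite matrix whose rows in `X` vanish
outside `T` is the sum of one supported on `T × T` and one whose rows in `X` vanish. -/
lemma PosSemidef.exists_add_of_rows [DecidableEq V] (X T : Finset V) :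
    ∀ {A : Matrix V V ℝ}, A.PosSemidef → (∀ i ∈ X, ∀ j, j ∉ T → A i j = 0) →
      ∃ B C : Matrix V V ℝ, B.PosSemidef ∧ C.PosSemidef ∧ A = B + C ∧
        (∀ i j, i ∉ T ∨ j ∉ T → B i j = 0) ∧ ∀ i ∈ X, ∀ j, C i j = 0 := by
  induction X using Finset.induction_on with
  | empty => exact fun {A} hA _ => ⟨0, A, .zero, hA, by simp, by simp, by simp⟩
  | @insert p X hp ih =>
    intro A hA hX
    obtain ⟨ζ, hζ, hrow, hζA⟩ := hA.exists_sub_vecMulVec p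
    have hζT : ∀ j, j ∉ T → ζ j = 0 := fun j hj => by simp [hζA, hX p (by simp) j hj]
    obtain ⟨B, C, hB, hC, hBC, hBT, hCX⟩ := ih hζ fun i hi j hj => by
      simp [vecMulVec_apply, hζT j hj, hX i (by simp [hi]) j hj]
    refine ⟨vecMulVec ζ ζ + B, C, (posSemidef_vecMulVec_self ζ).add hB, hC, ?_, ?_, ?_⟩
    · rw [add_assoc, ← hBC]; abel
    · intro i j hij
      rw [add_apply, hBT i j hij, vecMulVec_apply]
      rcases hij with h | h <;> simp [hζT _ h]
    · intro i hi j
      rcases Finset.mem_insert.1 hi with rfl | hi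
      · refine hC.apply_eq_zero ?_ j
        have h := congrFun (congrFun hBC i) i
        rw [hrow, add_apply] at h
        have := hB.diag_nonneg (i := i)
        have := hC.diag_nonneg (i := i)
        linarith
      · exact hCX i hi j

/-- Pointwise limits of positive semidefinite matrices are positive semidefinite. -/
lemma posSemidef_of_tendsto {ι : Type*} {l : Filter ι} [l.NeBot] {M : ι → Matrix V V ℝ}
    (hM : ∀ i j, Tendsto (fun t => M t i j) l (𝓝 (A i j))) (h : ∀ᶠ t in l, (M t).PosSemidef) :
    A.PosSemidef := by
  refine PosSemidef.of_dotProduct_mulVec_nonneg ?_ fun x => ?_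
  · ext i j
    refine tendsto_nhds_unique_of_eventuallyEq (hM j i) (hM i j) ?_
    filter_upwards [h] with t ht using ht.apply_symm j i
  · refine ge_of_tendsto (f := fun t => star x ⬝ᵥ M t *ᵥ x) ?_
      (h.mono fun t ht => ht.dotProduct_mulVec_nonneg x)
    simp only [dotProduct, mulVec]
    exact tendsto_finsetSum _ fun i _ => tendsto_const_nhds.mul
      (tendsto_finsetSum _ fun j _ => (hM i j).mul tendsto_const_nhds)

/-- A matrix-valued function with positive semidefinite derivative increases in the Loewner
order. -/
lemma posSemidef_sub_of_hasDerivAt {M M' : ℝ → Matrix V V ℝ} (h0 : (M 0).IsHermitian)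
    (h1 : (M 1).IsHermitian) (hd : ∀ i j t, HasDerivAt (fun t => M t i j) (M' t i j) t)
    (hM' : ∀ t, 0 < t → t < 1 → (M' t).PosSemidef) : (M 1 - M 0).PosSemidef := by
  refine PosSemidef.of_dotProduct_mulVec_nonneg (h1.sub h0) fun x => ?_
  have hq : ∀ t, HasDerivAt (fun t => star x ⬝ᵥ M t *ᵥ x) (star x ⬝ᵥ M' t *ᵥ x) t := by
    intro t
    simp only [dotProduct, mulVec]
    exact HasDerivAt.fun_sum fun i _ => (HasDerivAt.fun_sum fun j _ =>
      (hd i j t).mul_const (x j)).const_mul _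
  have hmono : MonotoneOn (fun t => star x ⬝ᵥ M t *ᵥ x) (Set.Icc 0 1) := by
    refine monotoneOn_of_hasDerivWithinAt_nonneg (convex_Icc 0 1)
      (fun t _ => (hq t).continuousAt.continuousWithinAt)
      (fun t _ => (hq t).hasDerivWithinAt) fun t ht => ?_
    rw [interior_Icc] at ht
    exact (hM' t ht.1 ht.2).dotProduct_mulVec_nonneg x
  have := hmono (Set.left_mem_Icc.2 zero_le_one) (Set.right_mem_Icc.2 zero_le_one) zero_le_one
  simpa [sub_mulVec, dotProduct_sub] using this

lemma PosSemidef.restrict [DecidableEq V] (hA : A.PosSemidef) (W : Finset V) :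
    (Matrix.restrict W A).PosSemidef := by
  convert hA.hadamard_real (posSemidef_vecMulVec_self fun i => if i ∈ W then (1 : ℝ) else 0)
    using 1
  ext i j
  by_cases hi : i ∈ W <;> by_cases hj : j ∈ W <;> simp [Matrix.restrict, vecMulVec_apply, hi, hj]

end Matrix

/-! ### Loewner positivity, monotonicity and superadditivity of signed powers -/

namespace Matrix

open Filter Topology

variable {V : Type*} [Fintype V] {A B : Matrix V V ℝ}

/-- The rank one case: powers are multiplicative. -/
lemma posSemidef_map_signPow_vecMulVec (σ : Bool) (β : ℝ) (ζ : V → ℝ) :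
    ((vecMulVec ζ ζ).map (signPow σ β)).PosSemidef := by
  convert posSemidef_vecMulVec_self fun i => signPow σ β (ζ i)
  ext i j
  simp [vecMulVec_apply, signPow_mul]

/-- Differentiating along the segment from `B` to `A`. -/
lemma posSemidef_map_signPow_sub (σ : Bool) {β : ℝ} (hβ : 1 < β) (hA : A.IsHermitian)
    (hB : B.IsHermitian)
    (h : ∀ t : ℝ, 0 < t → t < 1 →
      ((A - B) ⊙ (B + t • (A - B)).map (signPow (!σ) (β - 1))).PosSemidef) :
    (A.map (signPow σ β) - B.map (signPow σ β)).PosSemidef := by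
  have key := posSemidef_sub_of_hasDerivAt (M := fun t => (B + t • (A - B)).map (signPow σ β))
    (M' := fun t => β • ((A - B) ⊙ (B + t • (A - B)).map (signPow (!σ) (β - 1))))
    (by simpa using hB.map_real _) (by simpa using hA.map_real _) (fun i j t => ?_)
    fun t h0 h1 => (h t h0 h1).smul (by linarith)
  · simpa using key
  · have hlin : HasDerivAt (fun t : ℝ => B i j + t * (A i j - B i j)) (A i j - B i j) t := by
      simpa using ((hasDerivAt_id t).mul_const (A i j - B i j)).const_add (B i j)
    refine ((hasDerivAt_signPow σ hβ (B i j + t * (A i j - B i j))).comp t hlin).congr_deriv ?_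
    simp only [smul_apply, hadamard_apply, map_apply, add_apply, sub_apply, smul_eq_mul]
    ring

/-- A threshold on the exponent may be taken non-strict, by continuity in the exponent. -/
lemma posSemidef_signPow_of_forall_gt (σ : Bool) (β : ℝ) (C : (ℝ → ℝ) → Matrix V V ℝ)
    (hC : ∀ i j, Continuous fun γ => C (signPow σ γ) i j)
    (h : ∀ γ, β < γ → (C (signPow σ γ)).PosSemidef) : (C (signPow σ β)).PosSemidef :=
  posSemidef_of_tendsto (l := 𝓝[>] β) (M := fun γ => C (signPow σ γ))
    (fun i j => ((hC i j).tendsto β).mono_left nhdsWithin_le_nhds)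
    (by filter_upwards [self_mem_nhdsWithin] with γ hγ using h γ hγ)

/-- The `β`-th signed powers preserve positive semidefiniteness of matrices of size at most
`⌊β⌋ + 2`. Subtracting a rank one matrix reduces the size by one, and differentiating along the
segment between the two matrices reduces the exponent by one. -/
theorem PosSemidef.map_signPow (n : ℕ) : ∀ (U : Finset V), U.card ≤ n + 2 → ∀ (σ : Bool) (β : ℝ),
    n ≤ β → ∀ {A : Matrix V V ℝ}, A.PosSemidef → A.SupportedOn U →
      (A.map (signPow σ β)).PosSemidef := by
  classical
  induction n with
  | zero =>
    intro U hU σ β hβ A hA hAU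
    rw [Nat.cast_zero] at hβ
    rcases U.eq_empty_or_nonempty with rfl | ⟨p, hp⟩
    · rw [hAU.eq_zero, Matrix.map_zero _ (signPow_zero σ β)]
      exact .zero
    obtain ⟨ζ, hζ, hrow, hζA⟩ := hA.exists_sub_vecMulVec p
    have hsupp := hAU.sub_vecMulVec_erase hA hrow hζA
    have hcard : (U.erase p).card ≤ 1 := by rw [Finset.card_erase_of_mem hp]; omega
    have hdiag : (A.map (signPow σ β) - (vecMulVec ζ ζ).map (signPow σ β)) =
        diagonal fun i => signPow σ β (A i i) - signPow σ β (vecMulVec ζ ζ i i) := by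
      ext i j
      rcases eq_or_ne i j with rfl | hij
      · simp
      · have := hsupp.apply_eq_zero_of_card_le_one hcard hij
        rw [sub_apply, sub_eq_zero] at this
        simp [hij, this]
    have h := (posSemidef_map_signPow_vecMulVec σ β ζ).add (B := A.map (signPow σ β) -
        (vecMulVec ζ ζ).map (signPow σ β)) (hdiag ▸ PosSemidef.diagonal fun i => ?_)
    · simpa using h
    · refine sub_nonneg.2 (signPow_le_signPow σ hβ ?_ ?_)
      · simpa [vecMulVec_apply] using mul_self_nonneg (ζ i)
      · simpa using hζ.diag_nonneg (i := i)
  | succ n ih =>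
    intro U hU σ β hβ A hA hAU
    refine posSemidef_signPow_of_forall_gt σ β (fun f => A.map f)
      (fun i j => continuous_signPow_exponent σ (A i j)) fun γ hγ => ?_
    push_cast at hβ
    rcases U.eq_empty_or_nonempty with rfl | ⟨p, hp⟩
    · rw [hAU.eq_zero, Matrix.map_zero _ (signPow_zero σ γ)]
      exact .zero
    obtain ⟨ζ, hζ, hrow, hζA⟩ := hA.exists_sub_vecMulVec p
    have hsupp := hAU.sub_vecMulVec_erase hA hrow hζA
    have hcard : (U.erase p).card ≤ n + 2 := by rw [Finset.card_erase_of_mem hp]; omega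
    have hn : (0 : ℝ) ≤ n := n.cast_nonneg
    have h := (posSemidef_map_signPow_vecMulVec σ γ ζ).add
      (posSemidef_map_signPow_sub (A := A) (B := vecMulVec ζ ζ) σ (by linarith) hA.1
        (posSemidef_vecMulVec_self ζ).1 fun t h0 _ => ?_)
    · simpa using h
    · -- only the block of the second factor indexed by `U.erase p` matters
      have hR := ih (U.erase p) hcard (!σ) (γ - 1) (by linarith)
        (((posSemidef_vecMulVec_self ζ).add (hζ.smul h0.le)).restrict (U.erase p))
        (supportedOn_restrict _ _)
      convert hζ.hadamard_real hR using 1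
      ext i j
      simp only [hadamard_apply, map_apply, Matrix.restrict, of_apply]
      by_cases hij : i ∈ U.erase p ∧ j ∈ U.erase p
      · rw [if_pos hij]
      · rw [hsupp i j (by tauto), zero_mul, zero_mul]

/-- Loewner monotonicity of the signed powers. -/
theorem PosSemidef.map_signPow_sub_map_signPow {U : Finset V} {m : ℕ} (hm : 2 ≤ m)
    (hU : U.card ≤ m) (σ : Bool) {γ : ℝ} (hγ : m - 1 < γ) (hA : A.PosSemidef) (hB : B.PosSemidef)
    (hAU : A.SupportedOn U) (hBU : B.SupportedOn U) :
    ((A + B).map (signPow σ γ) - B.map (signPow σ γ)).PosSemidef := by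
  have hm' : (2 : ℝ) ≤ m := by exact_mod_cast hm
  refine posSemidef_map_signPow_sub σ (by linarith) (hA.add hB).1 hB.1 fun t h0 _ => ?_
  rw [add_sub_cancel_right]
  refine hA.hadamard_real (PosSemidef.map_signPow (m - 2) U (by omega) _ _ ?_
    (hB.add (hA.smul h0.le)) (hBU.add (hAU.smul t)))
  rw [Nat.cast_sub hm, Nat.cast_ofNat]
  linarith

/-- Loewner superadditivity of the `β`-th signed powers on matrices of size at most `⌊β⌋`. -/
theorem PosSemidef.map_signPow_add_sub {U : Finset V} (σ : Bool) {β : ℝ} (hU : U.card ≤ β)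
    (hA : A.PosSemidef) (hB : B.PosSemidef) (hAU : A.SupportedOn U) (hBU : B.SupportedOn U) :
    ((A + B).map (signPow σ β) - A.map (signPow σ β) - B.map (signPow σ β)).PosSemidef := by
  classical
  rcases Nat.lt_or_ge U.card 2 with hm | hm
  · -- at most one diagonal entry is nonzero
    have hdiag : (A + B).map (signPow σ β) - A.map (signPow σ β) - B.map (signPow σ β) =
        diagonal fun i => signPow σ β (A i i + B i i) - signPow σ β (A i i)
          - signPow σ β (B i i) := by
      ext i j
      rcases eq_or_ne i j with rfl | hij
      · simp
      · simp [hij, hAU.apply_eq_zero_of_card_le_one (by omega) hij,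
          hBU.apply_eq_zero_of_card_le_one (by omega) hij]
    rw [hdiag]
    refine PosSemidef.diagonal fun i => ?_
    simp only [Pi.zero_apply]
    by_cases hi : i ∈ U
    · have hβ : 1 ≤ β := by
        have : (1 : ℝ) ≤ U.card := by exact_mod_cast Finset.card_pos.2 ⟨i, hi⟩
        linarith
      rcases (hA.diag_nonneg (i := i)).eq_or_lt with ha | ha
      · simp [← ha]
      rcases (hB.diag_nonneg (i := i)).eq_or_lt with hb | hb
      · simp [← hb]
      rw [signPow_of_pos _ _ ha, signPow_of_pos _ _ hb, signPow_of_pos _ _ (add_pos ha hb)]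
      linarith [Real.add_rpow_le_rpow_add ha.le hb.le hβ]
    · simp [hAU i i (Or.inl hi), hBU i i (Or.inl hi)]
  refine posSemidef_signPow_of_forall_gt σ β (fun f => (A + B).map f - A.map f - B.map f)
    (fun i j => ((continuous_signPow_exponent σ _).sub (continuous_signPow_exponent σ _)).sub
      (continuous_signPow_exponent σ _)) fun γ hγ => ?_
  have hm' : (2 : ℝ) ≤ U.card := by exact_mod_cast hm
  have hγ1 : 1 < γ := by linarith
  have hherm : ∀ t : ℝ,
      ((A + t • B).map (signPow σ γ) - (t • B).map (signPow σ γ)).IsHermitian := fun t =>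
    ((hA.1.add (hB.1.smul (.all t))).map_real _).sub ((hB.1.smul (.all t)).map_real _)
  -- differentiate `t ↦ f[A + t B] - f[t B]`
  have key := posSemidef_sub_of_hasDerivAt
    (M := fun t => (A + t • B).map (signPow σ γ) - (t • B).map (signPow σ γ))
    (M' := fun t => γ • (B ⊙ ((A + t • B).map (signPow (!σ) (γ - 1)) -
      (t • B).map (signPow (!σ) (γ - 1)))))
    (hherm 0) (hherm 1) (fun i j t => ?_)
    fun t h0 _ => PosSemidef.smul (hB.hadamard_real (PosSemidef.map_signPow_sub_map_signPow hm
      le_rfl _ (by linarith) hA (hB.smul h0.le) hAU (hBU.smul t))) (by linarith)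
  · convert key using 1
    ext i j
    simp
    ring
  · have hlin : HasDerivAt (fun t : ℝ => t * B i j) (B i j) t := by
      simpa using (hasDerivAt_id t).mul_const (B i j)
    refine (((hasDerivAt_signPow σ hγ1 (A i j + t * B i j)).comp t (hlin.const_add _)).sub
      ((hasDerivAt_signPow σ hγ1 (t * B i j)).comp t hlin)).congr_deriv ?_
    simp only [smul_apply, hadamard_apply, map_apply, add_apply, sub_apply, smul_eq_mul]
    ring

end Matrix

/-! ### The upper bound -/

open Matrix in
/-- Let `G` be chordal without cliques of size `r + 3` and such that the cliques in the common
neighbourhood of two non-adjacent vertices have size at most `r`. Then the signed powers with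
exponent at least `r` preserve positive semidefiniteness on the cone of `G`. By induction on the
support `U`: if it is not a clique, a clique separator of size at most `r` splits the matrix into
two positive semidefinite parts, and superadditivity on the separator compares the power of the
matrix to the powers of the parts. -/
theorem IsChordal.posSemidef_map_signPow {V : Type*} [Fintype V] {G : SimpleGraph V}
    (hG : IsChordal G) {r : ℕ}
    (hcl : ∀ S : Finset V, G.IsClique (S : Set V) → S.card ≤ r + 2)
    (hsep : ∀ (a b : V) (S : Finset V), a ≠ b → ¬ G.Adj a b → G.IsClique (S : Set V) →
      (∀ s ∈ S, G.Adj s a ∧ G.Adj s b) → S.card ≤ r)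
    (σ : Bool) {β : ℝ} (hβ : r ≤ β) (U : Finset V) :
    ∀ {A : Matrix V V ℝ}, A.PosSemidef → (∀ i j, i ≠ j → ¬ G.Adj i j → A i j = 0) →
      A.SupportedOn U → (A.map (signPow σ β)).PosSemidef := by
  classical
  induction U using Finset.strongInduction with
  | H U ih =>
  intro A hA hAG hAU
  by_cases hU : G.IsClique (U : Set V)
  · exact hA.map_signPow r U (hcl U hU) σ β hβ hAU
  obtain ⟨X, S, hXU, hSU, hX, hne, hS, hXadj, a, b, hab, hnadj, hSab⟩ :=
    hG.exists_separation hU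
  have hrow : ∀ i ∈ X, ∀ j, j ∉ X ∪ S → A i j = 0 := by
    intro i hi j hj
    by_cases hjU : j ∈ U
    · refine hAG i j ?_ fun h => hj (hXadj i hi j hjU h)
      rintro rfl
      exact hj (Finset.mem_union_left _ hi)
    · exact hAU i j (Or.inr hjU)
  obtain ⟨B, C, hB, hC, hBC, hBT, hCX⟩ := hA.exists_add_of_rows X (X ∪ S) hrow
  have hBCij : ∀ i j, A i j = B i j + C i j := fun i j => by rw [hBC, Matrix.add_apply]
  have hXSU : X ∪ S ⊆ U := Finset.union_subset hXU hSU
  have hCX' : ∀ i j, i ∈ X ∨ j ∈ X → C i j = 0 := by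
    rintro i j (h | h)
    · exact hCX i h j
    · rw [hC.apply_symm]; exact hCX j h i
  have hCU : C.SupportedOn (U \ X) := by
    intro i j h
    by_cases hX' : i ∈ X ∨ j ∈ X
    · exact hCX' i j hX'
    · push Not at hX'
      have h' : i ∉ U ∨ j ∉ U := by
        simp only [Finset.mem_sdiff, not_and, not_not] at h
        tauto
      have h1 := hBCij i j
      rw [hAU i j h', hBT i j (h'.imp (fun h h' => h (hXSU h')) fun h h' => h (hXSU h'))] at h1
      linarith
  -- the two parts overlap in `S × S` only
  have hzero : ∀ i j, ¬ (i ∈ S ∧ j ∈ S) → B i j = 0 ∨ C i j = 0 := by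
    intro i j hij
    by_cases h : i ∈ X ∪ S ∧ j ∈ X ∪ S
    · right
      apply hCX'
      simp only [Finset.mem_union] at h
      tauto
    · exact Or.inl (hBT i j (by tauto))
  have hSadj : ∀ i j, i ≠ j → ¬ G.Adj i j → ¬ (i ∈ S ∧ j ∈ S) :=
    fun i j hij hn h => hn (hS h.1 h.2 hij)
  have hsum0 : ∀ i j, i ≠ j → ¬ G.Adj i j → B i j = 0 ∧ C i j = 0 := by
    intro i j hij hn
    have h1 := hBCij i j
    rw [hAG i j hij hn] at h1
    rcases hzero i j (hSadj i j hij hn) with h | h <;> constructor <;> linarith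
  have hfB := ih (X ∪ S) (Finset.ssubset_iff_subset_ne.2 ⟨hXSU, hne⟩) hB
    (fun i j hij hn => (hsum0 i j hij hn).1) hBT
  have hfC := ih (U \ X) (Finset.sdiff_ssubset hXU hX) hC
    (fun i j hij hn => (hsum0 i j hij hn).2) hCU
  have hScard : (S.card : ℝ) ≤ β :=
    le_trans (by exact_mod_cast hsep a b S hab hnadj hS hSab) hβ
  have hE := PosSemidef.map_signPow_add_sub σ hScard (hB.restrict S) (hC.restrict S)
    (supportedOn_restrict S B) (supportedOn_restrict S C)
  convert (hfB.add hfC).add hE using 1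
  ext i j
  simp only [map_apply, Matrix.add_apply, Matrix.sub_apply, Matrix.restrict, of_apply, hBCij]
  by_cases hij : i ∈ S ∧ j ∈ S
  · simp only [if_pos hij]; ring
  · simp only [if_neg hij]
    rcases hzero i j hij with h | h <;> simp [h]

/-! ### Weights annihilating small integral powers -/

section Weights

open Finset

/-- The forward differences of order `n` of `t ↦ t ^ γ` are positive on `(0, ∞)` if `n - 1 < γ`:
their derivatives are multiples of the differences of `t ↦ t ^ (γ - 1)`. -/
lemma fwdDiff_iter_rpow_pos (n : ℕ) :
    ∀ {γ : ℝ}, (n : ℝ) - 1 < γ → ∀ {x : ℝ}, 0 < x →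
      0 < (fwdDiff (1 : ℝ))^[n] (fun t : ℝ => t ^ γ) x := by
  induction n with
  | zero => intro γ _ x hx; simpa using Real.rpow_pos_of_pos hx γ
  | succ n ih =>
    intro γ hγ x hx
    push_cast at hγ
    have hn : (0 : ℝ) ≤ n := n.cast_nonneg
    have hd : ∀ y : ℝ, 0 < y → HasDerivAt ((fwdDiff (1 : ℝ))^[n] (fun t : ℝ => t ^ γ))
        (γ * (fwdDiff (1 : ℝ))^[n] (fun t : ℝ => t ^ (γ - 1)) y) y := by
      intro y hy
      have hfun : (fwdDiff (1 : ℝ))^[n] (fun t : ℝ => t ^ γ) = fun y => ∑ k ∈ range (n + 1),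
          (((-1 : ℤ) ^ (n - k) * n.choose k : ℤ) : ℝ) * (y + k) ^ γ := by
        ext y
        simp [fwdDiff_iter_eq_sum_shift]
      rw [hfun, fwdDiff_iter_eq_sum_shift, mul_sum]
      have hterm : ∀ k : ℕ, HasDerivAt (fun y : ℝ => (y + k) ^ γ) (γ * (y + k) ^ (γ - 1)) y := by
        intro k
        simpa using ((hasDerivAt_id y).add_const (k : ℝ)).rpow_const (p := γ)
          (Or.inl (by simp only [id]; positivity))
      refine (HasDerivAt.fun_sum fun k _ => (hterm k).const_mul _).congr_deriv
        (sum_congr rfl fun k _ => ?_)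
      rw [zsmul_eq_mul, nsmul_eq_mul, mul_one]
      ring
    have hmono : StrictMonoOn ((fwdDiff (1 : ℝ))^[n] (fun t : ℝ => t ^ γ)) (Set.Ioi 0) := by
      refine strictMonoOn_of_deriv_pos (convex_Ioi 0)
        (fun y hy => (hd y hy).continuousAt.continuousWithinAt) fun y hy => ?_
      rw [interior_Ioi] at hy
      rw [(hd y hy).deriv]
      exact mul_pos (by linarith) (ih (by linarith) hy)
    rw [Function.iterate_succ_apply', fwdDiff, sub_pos]
    exact hmono (Set.mem_Ioi.2 hx) (Set.mem_Ioi.2 (by linarith)) (by linarith)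

/-- There are weights on the points `1, …, r` that annihilate `t, …, t ^ (r - 1)` but not `t ^ β`,
where `r - 1 < β`. -/
lemma exists_weights {r : ℕ} (hr : 1 ≤ r) {β : ℝ} (hβ : (r : ℝ) - 1 < β) :
    ∃ w : ℕ → ℝ, (∀ j, 1 ≤ j → j < r → ∑ k ∈ range r, w k * ((k : ℝ) + 1) ^ j = 0) ∧
      0 < ∑ k ∈ range r, w k * ((k : ℝ) + 1) ^ β := by
  obtain ⟨n, rfl⟩ := Nat.exists_eq_add_of_le' hr
  push_cast at hβ
  refine ⟨fun k => (((-1 : ℤ) ^ (n - k) * n.choose k : ℤ) : ℝ) / (k + 1), fun j hj hjr => ?_, ?_⟩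
  · obtain ⟨i, rfl⟩ := Nat.exists_eq_add_of_le' hj
    have h := congrFun (fwdDiff_iter_pow_eq_zero_of_lt (R := ℝ) (show i < n by omega)) 1
    rw [fwdDiff_iter_eq_sum_shift, Pi.zero_apply] at h
    rw [← h]
    refine sum_congr rfl fun k _ => ?_
    have : (k : ℝ) + 1 ≠ 0 := by positivity
    rw [zsmul_eq_mul, nsmul_eq_mul, mul_one, add_comm (1 : ℝ), pow_succ]
    field_simp
  · have h := fwdDiff_iter_rpow_pos n (γ := β - 1) (by linarith) one_pos
    rw [fwdDiff_iter_eq_sum_shift] at h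
    refine h.trans_eq (sum_congr rfl fun k _ => ?_)
    have hk : (0 : ℝ) < (k : ℝ) + 1 := by positivity
    rw [zsmul_eq_mul, nsmul_eq_mul, mul_one, add_comm (1 : ℝ), Real.rpow_sub_one hk.ne']
    ring

end Weights

/-! ### Failure of superadditivity below the threshold -/

section Failure

open Finset Filter Topology

/-- Taylor expansion of `(1 + y) ^ β` at `0`, with a one-sided bound on the remainder. -/
lemma exists_taylor_one_add_rpow (β : ℝ) {r : ℕ} (hr : 1 ≤ r) :
    ∃ (c : ℕ → ℝ) (C : ℝ), c 0 = 1 ∧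
      ∀ y ∈ Set.Icc (0 : ℝ) 1, |(1 + y) ^ β - ∑ j ∈ range r, c j * y ^ j| ≤ C * y ^ r := by
  obtain ⟨n, rfl⟩ := Nat.exists_eq_add_of_le' hr
  have hf : ContDiffOn ℝ (n + 1) (fun y : ℝ => (1 + y) ^ β) (Set.Icc 0 1) := by
    refine (contDiffOn_const.add contDiffOn_id).rpow_const_of_ne fun y hy => ?_
    have := hy.1
    simp only [id]
    positivity
  obtain ⟨C, hC⟩ := exists_taylor_mean_remainder_bound zero_le_one hf
  refine ⟨fun j => (j.factorial : ℝ)⁻¹ *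
    iteratedDerivWithin j (fun y : ℝ => (1 + y) ^ β) (Set.Icc 0 1) 0, C, by simp, fun y hy => ?_⟩
  have h := hC y hy
  rw [taylor_within_apply, Real.norm_eq_abs, sub_zero] at h
  convert h using 4 with j
  rw [smul_eq_mul]
  ring

lemma sum_mul_sum_mul_self {ι : Type*} (s : Finset ι) (c : ℝ) (w g : ι → ℝ) :
    ∑ k ∈ s, ∑ l ∈ s, w k * w l * (c * (g k * g l)) = c * (∑ k ∈ s, w k * g k) ^ 2 := by
  rw [sq, sum_mul_sum, mul_sum]
  refine sum_congr rfl fun k _ => ?_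
  rw [mul_sum]
  exact sum_congr rfl fun l _ => by ring

/-- For `r - 1 < β < r` the `β`-th power is not Loewner superadditive on `r × r` matrices, as
witnessed by the all ones matrix and a small multiple of the rank one matrix `(k l)`. -/
lemma exists_sum_rpow_neg {r : ℕ} (hr : 1 ≤ r) {β : ℝ} (h1 : (r : ℝ) - 1 < β) (h2 : β < r) :
    ∃ (w : ℕ → ℝ) (ε : ℝ), 0 < ε ∧ ∑ k ∈ range r, ∑ l ∈ range r, w k * w l *
      ((1 + ε * (((k : ℝ) + 1) * ((l : ℝ) + 1))) ^ β - 1 -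
        (ε * (((k : ℝ) + 1) * ((l : ℝ) + 1))) ^ β) < 0 := by
  obtain ⟨w, hw, hK⟩ := exists_weights hr h1
  obtain ⟨c, C, hc0, hC⟩ := exists_taylor_one_add_rpow β hr
  set K := ∑ k ∈ range r, w k * ((k : ℝ) + 1) ^ β with hKdef
  set D := ∑ k ∈ range r, ∑ l ∈ range r,
    |w k * w l| * (C * (((k : ℝ) + 1) * ((l : ℝ) + 1)) ^ r) with hDdef
  have hr0 : (0 : ℝ) < r := by exact_mod_cast hr
  have hlim : Tendsto (fun ε : ℝ => ε ^ ((r : ℝ) - β) * D) (𝓝[>] 0) (𝓝 0) := by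
    have : ContinuousAt (fun ε : ℝ => ε ^ ((r : ℝ) - β) * D) 0 :=
      (Real.continuousAt_rpow_const _ _ (Or.inr (by linarith))).mul continuousAt_const
    simpa [Real.zero_rpow (by linarith : (r : ℝ) - β ≠ 0)] using
      this.tendsto.mono_left nhdsWithin_le_nhds
  have hev : ∀ᶠ ε : ℝ in 𝓝[>] 0, 0 < ε ∧ ε < 1 / r ^ 2 ∧ ε ^ ((r : ℝ) - β) * D < K ^ 2 := by
    filter_upwards [self_mem_nhdsWithin, hlim.eventually_lt_const (by positivity : 0 < K ^ 2),
      (eventually_lt_nhds (by positivity : (0 : ℝ) < 1 / r ^ 2)).filter_mono nhdsWithin_le_nhds]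
      with ε h h' h'' using ⟨h, h'', h'⟩
  obtain ⟨ε, hε, hεr, hεK⟩ := hev.exists
  refine ⟨w, ε, hε, ?_⟩
  have hx : ∀ k ∈ range r, (0 : ℝ) < (k : ℝ) + 1 ∧ (k : ℝ) + 1 ≤ r := fun k hk =>
    ⟨by positivity, by exact_mod_cast mem_range.1 hk⟩
  -- the remainder term
  have hR : ∑ k ∈ range r, ∑ l ∈ range r, w k * w l *
      ((1 + ε * (((k : ℝ) + 1) * ((l : ℝ) + 1))) ^ β -
        ∑ j ∈ range r, c j * (ε * (((k : ℝ) + 1) * ((l : ℝ) + 1))) ^ j) ≤ ε ^ r * D := by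
    rw [hDdef, mul_sum]
    refine sum_le_sum fun k hk => ?_
    rw [mul_sum]
    refine sum_le_sum fun l hl => ?_
    obtain ⟨hk0, hkr⟩ := hx k hk
    obtain ⟨hl0, hlr⟩ := hx l hl
    have hy0 : 0 ≤ ε * (((k : ℝ) + 1) * ((l : ℝ) + 1)) := by positivity
    have hy1 : ε * (((k : ℝ) + 1) * ((l : ℝ) + 1)) ≤ 1 :=
      calc ε * (((k : ℝ) + 1) * ((l : ℝ) + 1)) ≤ 1 / r ^ 2 * (r * r) := by gcongr
        _ = 1 := by field_simp
    refine (le_abs_self _).trans ?_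
    rw [abs_mul]
    calc _ ≤ |w k * w l| * (C * (ε * (((k : ℝ) + 1) * ((l : ℝ) + 1))) ^ r) := by
            gcongr
            exact hC _ ⟨hy0, hy1⟩
      _ = _ := by rw [mul_pow]; ring
  -- the polynomial terms of positive degree vanish
  have hP : ∑ k ∈ range r, ∑ l ∈ range r, w k * w l *
      (∑ j ∈ range r, c j * (ε * (((k : ℝ) + 1) * ((l : ℝ) + 1))) ^ j - 1) = 0 := by
    have hsplit : ∀ y : ℝ, ∑ j ∈ range r, c j * y ^ j - 1 = ∑ j ∈ Ico 1 r, c j * y ^ j := by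
      intro y
      rw [range_eq_Ico, sum_eq_sum_Ico_succ_bot (by omega), hc0]
      simp
    simp only [hsplit]
    have hswap : ∑ k ∈ range r, ∑ l ∈ range r, w k * w l *
        (∑ j ∈ Ico 1 r, c j * (ε * (((k : ℝ) + 1) * ((l : ℝ) + 1))) ^ j) =
        ∑ j ∈ Ico 1 r, ∑ k ∈ range r, ∑ l ∈ range r,
          w k * w l * (c j * ε ^ j * (((k : ℝ) + 1) ^ j * ((l : ℝ) + 1) ^ j)) := by
      simp only [mul_sum]
      rw [sum_congr rfl fun k _ => sum_comm, sum_comm]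
      refine sum_congr rfl fun j _ => sum_congr rfl fun k _ => sum_congr rfl fun l _ => ?_
      rw [mul_pow, mul_pow]
      ring
    rw [hswap]
    refine sum_eq_zero fun j hj => ?_
    rw [mem_Ico] at hj
    rw [sum_mul_sum_mul_self, hw j hj.1 hj.2]
    ring
  -- the leading term
  have hL : ∑ k ∈ range r, ∑ l ∈ range r, w k * w l *
      (ε * (((k : ℝ) + 1) * ((l : ℝ) + 1))) ^ β = ε ^ β * K ^ 2 := by
    rw [hKdef, ← sum_mul_sum_mul_self]
    refine sum_congr rfl fun k hk => sum_congr rfl fun l hl => ?_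
    rw [Real.mul_rpow hε.le (by positivity), Real.mul_rpow (by positivity) (by positivity)]
  have hfinal : ε ^ r * D < ε ^ β * K ^ 2 := by
    have : ε ^ r * D = ε ^ β * (ε ^ ((r : ℝ) - β) * D) := by
      rw [← mul_assoc, ← Real.rpow_add hε, add_sub_cancel, Real.rpow_natCast]
    rw [this]
    have := Real.rpow_pos_of_pos hε β
    gcongr
  calc _ = (∑ k ∈ range r, ∑ l ∈ range r, w k * w l *
        ((1 + ε * (((k : ℝ) + 1) * ((l : ℝ) + 1))) ^ β -
          ∑ j ∈ range r, c j * (ε * (((k : ℝ) + 1) * ((l : ℝ) + 1))) ^ j)) +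
        (∑ k ∈ range r, ∑ l ∈ range r, w k * w l *
          (∑ j ∈ range r, c j * (ε * (((k : ℝ) + 1) * ((l : ℝ) + 1))) ^ j - 1)) -
        ∑ k ∈ range r, ∑ l ∈ range r, w k * w l *
          (ε * (((k : ℝ) + 1) * ((l : ℝ) + 1))) ^ β := by
        simp only [← sum_add_distrib, ← sum_sub_distrib]
        exact sum_congr rfl fun k _ => sum_congr rfl fun l _ => by ring
    _ < 0 := by rw [hP, hL]; linarith

end Failure

/-! ### The lower bound -/

section LowerBound

open Finset Matrix

variable {V : Type*} {G : SimpleGraph V}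

@[simp] lemma powFun_zero (β : ℝ) : powFun β 0 = 0 := if_pos rfl

lemma powFun_of_pos (β : ℝ) {x : ℝ} (hx : 0 < x) : powFun β x = x ^ β := if_neg hx.ne'

/-- A sum of two nonnegative rank one matrices supported on cliques lies in the cone of the
graph. -/
lemma add_vecMulVec_mem_graphCone [Finite V] {ζ η : V → ℝ} {K L : Set V} (hK : G.IsClique K)
    (hL : G.IsClique L) (hζ : ∀ v, 0 ≤ ζ v) (hη : ∀ v, 0 ≤ η v) (hζK : ∀ v ∉ K, ζ v = 0)
    (hηL : ∀ v ∉ L, η v = 0) :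
    vecMulVec ζ ζ + vecMulVec η η ∈ graphCone G (Set.Ici 0) := by
  have := Fintype.ofFinite V
  refine ⟨(posSemidef_vecMulVec_self ζ).add (posSemidef_vecMulVec_self η), fun i j => ?_,
    fun i j hij hadj => ?_⟩
  · simp only [Matrix.add_apply, vecMulVec_apply, Set.mem_Ici]
    have := mul_nonneg (hζ i) (hζ j)
    have := mul_nonneg (hη i) (hη j)
    linarith
  · have h : ∀ {ξ : V → ℝ} {C : Set V}, G.IsClique C → (∀ v ∉ C, ξ v = 0) → ξ i * ξ j = 0 := by
      intro ξ C hC hξ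
      by_cases hi : i ∈ C
      · by_cases hj : j ∈ C
        · exact absurd (hC hi hj hij) hadj
        · simp [hξ j hj]
      · simp [hξ i hi]
    simp only [Matrix.add_apply, vecMulVec_apply]
    rw [h hK hζK, h hL hηL, add_zero]

/-- An edge obstructs all negative exponents. -/
lemma exists_not_posSemidef_of_adj [Fintype V] {a b : V} (hab : G.Adj a b) {β : ℝ} (hβ : β < 0) :
    ∃ A ∈ graphCone G (Set.Ici 0), ¬ (A.map (powFun β)).PosSemidef := by
  classical
  set ζ : V → ℝ := fun v => if v = a ∨ v = b then 1 else 0 with hζ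
  set η : V → ℝ := fun v => if v = a then 1 else 0 with hη
  refine ⟨vecMulVec ζ ζ + vecMulVec η η, add_vecMulVec_mem_graphCone (K := {a, b}) (L := {a})
    ?_ ?_ ?_ ?_ ?_ ?_, fun h => ?_⟩
  · intro i hi j hj hij
    rcases hi with rfl | rfl <;> rcases hj with rfl | rfl
    · exact absurd rfl hij
    · exact hab
    · exact hab.symm
    · exact absurd rfl hij
  · simp
  · intro v; simp only [hζ]; split_ifs <;> norm_num
  · intro v; simp only [hη]; split_ifs <;> norm_num
  · intro v hv; simpa [hζ] using hv
  · intro v hv; simpa [hη] using hv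
  · -- the determinant of the block indexed by `a, b` is `2 ^ β - 1`
    obtain ⟨ξ, hξ, -, hξb⟩ := h.exists_sub_vecMulVec b
    have h1 : ((vecMulVec ζ ζ + vecMulVec η η).map (powFun β)) a a = 2 ^ β := by
      simp only [Matrix.map_apply, Matrix.add_apply, vecMulVec_apply, hζ, hη]
      norm_num [powFun]
    have h2 : ((vecMulVec ζ ζ + vecMulVec η η).map (powFun β)) b a = 1 := by
      simp [vecMulVec_apply, hζ, hη, powFun, hab.ne']
    have h3 : ((vecMulVec ζ ζ + vecMulVec η η).map (powFun β)) b b = 1 := by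
      simp [vecMulVec_apply, hζ, hη, powFun, hab.ne']
    have hpos := hξ.diag_nonneg (i := a)
    rw [Matrix.sub_apply, vecMulVec_apply, hξb, h1, h2, h3] at hpos
    have := Real.rpow_lt_one_of_one_lt_of_neg (one_lt_two : (1 : ℝ) < 2) hβ
    norm_num at hpos
    linarith

lemma exists_enumeration (S : Finset V) :
    ∃ x : V → ℕ, ∀ g : ℕ → ℝ, ∑ v ∈ S, g (x v) = ∑ k ∈ range S.card, g k := by
  classical
  refine ⟨fun v => if h : v ∈ S then S.equivFin ⟨v, h⟩ else 0, fun g => ?_⟩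
  rw [← sum_coe_sort S, ← Fin.sum_univ_eq_sum_range, ← S.equivFin.sum_comp]
  exact sum_congr rfl fun v _ => by simp

/-- A clique of size `r ≥ 1` together with two further vertices `a ≠ b` adjacent to all of it
obstructs the exponents in `(r - 1, r)`. The Schur complement of the `a` and `b` entries of the
power of a suitable matrix measures the failure of superadditivity. -/
lemma exists_not_posSemidef_of_clique [Fintype V] {S : Finset V} (hS : G.IsClique (S : Set V))
    (hS1 : 1 ≤ S.card) {a b : V} (hab : a ≠ b) (ha : ∀ s ∈ S, G.Adj s a)
    (hb : ∀ s ∈ S, G.Adj s b) {β : ℝ} (h1 : (S.card : ℝ) - 1 < β) (h2 : β < S.card) :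
    ∃ A ∈ graphCone G (Set.Ici 0), ¬ (A.map (powFun β)).PosSemidef := by
  classical
  obtain ⟨w, ε, hε, hneg⟩ := exists_sum_rpow_neg hS1 h1 h2
  obtain ⟨x, hx⟩ := exists_enumeration S
  have haS : a ∉ S := fun h => (ha a h).ne rfl
  have hbS : b ∉ S := fun h => (hb b h).ne rfl
  have hsε : 0 < √ε := Real.sqrt_pos.2 hε
  set ζ : V → ℝ := fun v => if v = a ∨ v ∈ S then 1 else 0 with hζ
  set η : V → ℝ := fun v => if v = b then 1 else if v ∈ S then √ε * (x v + 1) else 0 with hη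
  have hζa : ζ a = 1 := by simp [hζ]
  have hζb : ζ b = 0 := by simp [hζ, hab.symm, hbS]
  have hζS : ∀ v ∈ S, ζ v = 1 := fun v hv => by simp [hζ, hv]
  have hηa : η a = 0 := by simp [hη, hab, haS]
  have hηb : η b = 1 := by simp [hη]
  have hηS : ∀ v ∈ S, η v = √ε * (x v + 1) := fun v hv => by
    have : v ≠ b := fun h => hbS (h ▸ hv)
    simp [hη, hv, this]
  have hins : ∀ {c : V}, (∀ s ∈ S, G.Adj s c) → G.IsClique (insert c (S : Set V)) := fun hc =>
    SimpleGraph.isClique_insert.2 ⟨hS, fun s hs _ => (hc s hs).symm⟩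
  refine ⟨vecMulVec ζ ζ + vecMulVec η η, add_vecMulVec_mem_graphCone (hins ha) (hins hb)
    ?_ ?_ ?_ ?_, fun h => ?_⟩
  · intro v; simp only [hζ]; split_ifs <;> norm_num
  · intro v; simp only [hη]; split_ifs <;> positivity
  · intro v hv; simpa [hζ] using hv
  · intro v hv
    simp only [Set.mem_insert_iff, mem_coe, not_or] at hv
    simp [hη, hv.1, hv.2]
  set M := (vecMulVec ζ ζ + vecMulVec η η).map (powFun β) with hM
  have hMij : ∀ i j, M i j = powFun β (ζ i * ζ j + η i * η j) := fun i j => by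
    simp [hM, vecMulVec_apply]
  have hone : powFun β 1 = 1 := by simp [powFun]
  obtain ⟨ξ, hξ, -, hξa⟩ := h.exists_sub_vecMulVec a
  have hξS : ∀ v ∈ S, ξ v = 1 := fun v hv => by
    simp [hξa, hMij, hζa, hηa, hζS v hv, hone]
  have hξb : ξ b = 0 := by simp [hξa, hMij, hζa, hηa, hζb]
  obtain ⟨θ, hθ, -, hθb⟩ := hξ.exists_sub_vecMulVec b
  have hbb : (M - vecMulVec ξ ξ) b b = 1 := by
    simp [vecMulVec_apply, hξb, hMij, hζb, hηb, hone]
  have hθS : ∀ v ∈ S, θ v = (√ε * (x v + 1)) ^ β := fun v hv => by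
    have hpos : 0 < √ε * ((x v : ℝ) + 1) := by positivity
    rw [hθb, hbb, Matrix.sub_apply, vecMulVec_apply, hξb, hMij, hζb, hηb, hηS v hv,
      zero_mul, zero_mul, zero_add, one_mul, powFun_of_pos β hpos]
    simp
  have hentry : ∀ v ∈ S, ∀ u ∈ S, (M - vecMulVec ξ ξ - vecMulVec θ θ) v u =
      (1 + ε * (((x v : ℝ) + 1) * ((x u : ℝ) + 1))) ^ β - 1 -
        (ε * (((x v : ℝ) + 1) * ((x u : ℝ) + 1))) ^ β := by
    intro v hv u hu
    have hprod : √ε * ((x v : ℝ) + 1) * (√ε * ((x u : ℝ) + 1)) =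
        ε * (((x v : ℝ) + 1) * ((x u : ℝ) + 1)) := by
      rw [mul_mul_mul_comm, Real.mul_self_sqrt hε.le]
    simp only [Matrix.sub_apply, vecMulVec_apply]
    rw [hMij, hξS v hv, hξS u hu, hθS v hv, hθS u hu, hζS v hv, hζS u hu, hηS v hv, hηS u hu,
      ← Real.mul_rpow (by positivity) (by positivity), hprod, powFun_of_pos _ (by positivity),
      one_mul]
  have hquad := hθ.dotProduct_mulVec_nonneg fun v => if v ∈ S then w (x v) else 0
  refine absurd hquad (not_le.2 (lt_of_eq_of_lt ?_ hneg))
  simp only [star_trivial, dotProduct, mulVec, ite_mul, zero_mul, mul_ite, mul_zero, sum_ite_mem,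
    univ_inter]
  rw [← hx fun k => ∑ l ∈ range S.card, w k * w l *
    ((1 + ε * (((k : ℝ) + 1) * ((l : ℝ) + 1))) ^ β - 1 - (ε * (((k : ℝ) + 1) * ((l : ℝ) + 1))) ^ β)]
  refine sum_congr rfl fun v hv => ?_
  rw [← hx fun l => w (x v) * w l * ((1 + ε * (((x v : ℝ) + 1) * ((l : ℝ) + 1))) ^ β - 1 -
    (ε * (((x v : ℝ) + 1) * ((l : ℝ) + 1))) ^ β), mul_sum]
  refine sum_congr rfl fun u hu => ?_
  rw [hentry v hv u hu]
  ring

end LowerBound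

/-! ### Maximal cliques and the critical exponents -/

section MaxClique

open Finset Matrix

variable {V : Type*} {G : SimpleGraph V}

/-- Every clique of a finite graph extends to a maximal one. -/
lemma exists_maxClique_superset [Finite V] {S : Finset V} (hS : G.IsClique (S : Set V)) :
    ∃ C : MaxClique G, S ⊆ C.1 := by
  obtain ⟨C, hSC, hC⟩ :=
    Finite.exists_le_maximal (p := fun s : Finset V => G.IsClique (s : Set V)) hS
  exact ⟨⟨C, hC⟩, hSC⟩

lemma col_dotProduct_col [Fintype V] [DecidableEq V] (C D : MaxClique G) :
    (maxCliqueMatrix G).col C ⬝ᵥ (maxCliqueMatrix G).col D = (C.1 ∩ D.1).card := by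
  simp [dotProduct, maxCliqueMatrix, ← ite_and, ← mem_inter, inter_comm]

/-- Cliques `S ∪ {a}` and `S ∪ {b}` with non-adjacent `a`, `b` lie in distinct maximal cliques. -/
lemma exists_maxClique_ne [Finite V] [DecidableEq V] {S : Finset V}
    (hS : G.IsClique (S : Set V)) {a b : V} (hab : a ≠ b) (hnadj : ¬ G.Adj a b)
    (h : ∀ s ∈ S, G.Adj s a ∧ G.Adj s b) :
    ∃ C D : MaxClique G, C ≠ D ∧ S ⊆ C.1 ∩ D.1 := by
  have hins : ∀ {c : V}, (∀ s ∈ S, G.Adj s c) → G.IsClique ((insert c S : Finset V) : Set V) :=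
    fun hc => by
      rw [coe_insert]
      exact SimpleGraph.isClique_insert.2 ⟨hS, fun s hs _ => (hc s hs).symm⟩
  obtain ⟨C, hC⟩ := exists_maxClique_superset (hins fun s hs => (h s hs).1)
  obtain ⟨D, hD⟩ := exists_maxClique_superset (hins fun s hs => (h s hs).2)
  rw [insert_subset_iff] at hC hD
  refine ⟨C, D, ?_, subset_inter hC.2 hD.2⟩
  rintro rfl
  exact hnadj (C.2.1 hC.1 hD.1 hab)

/-- Reduction of the computation of a critical exponent to nonnegative matrices below the
threshold and arbitrary matrices above it. -/
lemma isCriticalExponent_of {f : ℝ → ℝ → ℝ} {I : Set ℝ} {r : ℕ}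
    (hf : ∀ β x, 0 ≤ x → f β x = powFun β x) (hI : Set.Ici 0 ⊆ I)
    (hupper : ∀ A ∈ graphCone G I, ∀ β : ℝ, r ≤ β → (A.map (f β)).PosSemidef)
    (hlower : ∀ β : ℝ, (r : ℝ) - 1 < β → β < r →
      ∃ A ∈ graphCone G (Set.Ici 0), ¬ (A.map (powFun β)).PosSemidef) :
    IsCriticalExponent f I G r := by
  refine ⟨fun A hA β hβ => ⟨hupper A hA β hβ, fun _ _ => Set.mem_univ _, fun i j hij hadj => ?_⟩,
    fun α hα => ?_⟩
  · rw [Matrix.map_apply, hA.2.2 i j hij hadj, hf β 0 le_rfl, powFun_zero]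
  · by_contra! hlt
    obtain ⟨β, hβ, hβr⟩ := exists_between (max_lt hlt (sub_one_lt (r : ℝ)))
    obtain ⟨A, hA, hnot⟩ := hlower β ((le_max_right _ _).trans_lt hβ) hβr
    refine hnot ?_
    have h := (hα A ⟨hA.1, fun i j => hI (hA.2.1 i j), hA.2.2⟩ β ((le_max_left _ _).trans hβ.le)).1
    convert h using 1
    ext i j
    exact (hf β _ (hA.2.1 i j)).symm

end MaxClique

theorem corollary2p5 {V : Type*} [Fintype V] [DecidableEq V] (G : SimpleGraph V)
    (hG : IsChordal G) (hE : ∃ v w : V, G.Adj v w) :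
    ∃ c : ℝ,
      IsGreatest {x : ℝ | ∃ C D : MaxClique G,
        x = ((maxCliqueMatrix G).transpose * maxCliqueMatrix G
          - (2 : ℝ) • (1 : Matrix (MaxClique G) (MaxClique G) ℝ)) C D} c ∧
      IsGreatest {x : ℝ | ∃ C D : MaxClique G,
        x = dotProduct ((maxCliqueMatrix G).col C) ((maxCliqueMatrix G).col D)
          - 2 * (if C = D then 1 else 0)} c ∧
      IsCEH G c ∧ IsCEHpsi G c ∧ IsCEHphi G c := by
  obtain ⟨a, b, hab⟩ := hE
  -- the entries are integers, and the largest one is nonnegative since there is an edge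
  obtain ⟨C₂, hC₂⟩ := exists_maxClique_superset (G := G) (S := {a, b}) (by
    intro i hi j hj hij
    simp only [Finset.coe_insert, Finset.coe_singleton, Set.mem_insert_iff,
      Set.mem_singleton_iff] at hi hj
    rcases hi with rfl | rfl <;> rcases hj with rfl | rfl
    · exact absurd rfl hij
    · exact hab
    · exact hab.symm
    · exact absurd rfl hij)
  have hC₂card : 2 ≤ C₂.1.card := (Finset.card_pair hab.ne).symm.le.trans (Finset.card_le_card hC₂)
  have : Nonempty (MaxClique G × MaxClique G) := ⟨(C₂, C₂)⟩
  obtain ⟨⟨C₀, D₀⟩, hmax⟩ := Finite.exists_max fun P : MaxClique G × MaxClique G =>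
    ((P.1.1 ∩ P.2.1).card : ℤ) - 2 * (if P.1 = P.2 then 1 else 0)
  simp only [Prod.forall] at hmax
  have hr0 := hmax C₂ C₂
  rw [if_pos rfl, Finset.inter_self] at hr0
  obtain ⟨r, hr⟩ := Int.eq_ofNat_of_zero_le (a := ((C₀.1 ∩ D₀.1).card : ℤ) -
    2 * (if C₀ = D₀ then 1 else 0)) (by omega)
  rw [hr] at hmax
  have hcl : ∀ S : Finset V, G.IsClique (S : Set V) → S.card ≤ r + 2 := by
    intro S hS
    obtain ⟨C, hC⟩ := exists_maxClique_superset hS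
    have h := hmax C C
    rw [if_pos rfl, Finset.inter_self] at h
    have := Finset.card_le_card hC
    omega
  have hsep : ∀ (a b : V) (S : Finset V), a ≠ b → ¬ G.Adj a b → G.IsClique (S : Set V) →
      (∀ s ∈ S, G.Adj s a ∧ G.Adj s b) → S.card ≤ r := by
    intro a b S hab hnadj hS h
    obtain ⟨C, D, hCD, hsub⟩ := exists_maxClique_ne hS hab hnadj h
    have h := hmax C D
    rw [if_neg hCD] at h
    have := Finset.card_le_card hsub
    omega
  have hupper : ∀ σ : Bool, ∀ A ∈ graphCone G Set.univ, ∀ β : ℝ, r ≤ β →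
      (A.map (signPow σ β)).PosSemidef := fun σ A hA β hβ =>
    hG.posSemidef_map_signPow hcl hsep σ hβ Finset.univ hA.1 hA.2.2 (by intro i j h; simp at h)
  have hlower : ∀ β : ℝ, (r : ℝ) - 1 < β → β < r →
      ∃ A ∈ graphCone G (Set.Ici 0), ¬ (A.map (powFun β)).PosSemidef := by
    intro β h1 h2
    rcases Nat.eq_zero_or_pos r with rfl | hrpos
    · exact exists_not_posSemidef_of_adj hab (by simpa using h2)
    suffices H : ∃ (S : Finset V) (a b : V), S.card = r ∧ G.IsClique (S : Set V) ∧ a ≠ b ∧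
        (∀ s ∈ S, G.Adj s a) ∧ ∀ s ∈ S, G.Adj s b by
      obtain ⟨S, a, b, rfl, hS, hne, ha, hb⟩ := H
      exact exists_not_posSemidef_of_clique hS hrpos hne ha hb h1 h2
    by_cases hCD : C₀ = D₀
    · -- a clique of size `r + 2`
      rw [if_pos hCD, ← hCD, Finset.inter_self] at hr
      obtain ⟨a, ha, b, hb, hne⟩ := Finset.one_lt_card.1 (show 1 < C₀.1.card by omega)
      have hmem : ∀ s ∈ (C₀.1.erase a).erase b, s ≠ b ∧ s ≠ a ∧ s ∈ C₀.1 := fun s hs => by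
        simpa using hs
      refine ⟨(C₀.1.erase a).erase b, a, b, ?_, C₀.2.1.subset ?_, hne, fun s hs => ?_,
        fun s hs => ?_⟩
      · rw [Finset.card_erase_of_mem (Finset.mem_erase.2 ⟨hne.symm, hb⟩),
          Finset.card_erase_of_mem ha]
        omega
      · exact fun s hs => (hmem s hs).2.2
      · exact C₀.2.1 (hmem s hs).2.2 ha (hmem s hs).2.1
      · exact C₀.2.1 (hmem s hs).2.2 hb (hmem s hs).1
    · -- two distinct maximal cliques with `r` common vertices
      rw [if_neg hCD] at hr
      have hnot : ∀ {C D : MaxClique G}, C ≠ D → ∃ a ∈ C.1, a ∉ D.1 := by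
        intro C D hne
        by_contra! h
        exact hne (Subtype.ext (le_antisymm h (C.2.2 D.2.1 h)))
      obtain ⟨a, haC, haD⟩ := hnot hCD
      obtain ⟨b, hbD, hbC⟩ := hnot (Ne.symm hCD)
      refine ⟨C₀.1 ∩ D₀.1, a, b, by omega, C₀.2.1.subset ?_, fun h => hbC (h ▸ haC),
        fun s hs => ?_, fun s hs => ?_⟩
      · exact fun s hs => (Finset.mem_inter.1 hs).1
      · exact C₀.2.1 (Finset.mem_inter.1 hs).1 haC fun h => haD (h ▸ (Finset.mem_inter.1 hs).2)
      · exact D₀.2.1 (Finset.mem_inter.1 hs).2 hbD fun h => hbC (h ▸ (Finset.mem_inter.1 hs).1)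
  have hgreatest : IsGreatest {x : ℝ | ∃ C D : MaxClique G,
      x = (maxCliqueMatrix G).col C ⬝ᵥ (maxCliqueMatrix G).col D
        - 2 * (if C = D then 1 else 0)} (r : ℝ) := by
    simp only [col_dotProduct_col]
    refine ⟨⟨C₀, D₀, by exact_mod_cast hr.symm⟩, ?_⟩
    rintro _ ⟨C, D, rfl⟩
    exact_mod_cast hmax C D
  refine ⟨r, ?_, hgreatest, ?_, ?_, ?_⟩
  · convert hgreatest using 8 with x C D
    simp [Matrix.mul_apply, Matrix.one_apply, dotProduct]
  · refine isCriticalExponent_of (fun _ _ _ => rfl) subset_rfl (fun A hA β hβ => ?_) hlower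
    convert hupper true A ⟨hA.1, fun _ _ => Set.mem_univ _, hA.2.2⟩ β hβ using 1
    ext i j
    exact (signPow_of_nonneg true β (hA.2.1 i j)).symm
  · refine isCriticalExponent_of (fun β x hx => ?_) (Set.subset_univ _) (fun A hA β hβ => ?_) hlower
    · rw [← signPow_true, signPow_of_nonneg true β hx]
    · exact signPow_true β ▸ hupper true A hA β hβ
  · refine isCriticalExponent_of (fun β x hx => ?_) (Set.subset_univ _) (fun A hA β hβ => ?_) hlower
    · rw [← signPow_false, signPow_of_nonneg false β hx]
    · exact signPow_false β ▸ hupper false A hA β hβ
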